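/- **Setting.** A labeled graph is a pair $(G,\ell)$ where $G$ is a finite nonempty simple graph and $\ell:V(G)\to\{0,1\}^*$; a distributed language is a set of labeled graphs. Fix a function $N:\mathbb N\to\mathbb N$ with $N(n)\ge n$ that is bounded by a polynomial, and a class $\mathcal G$ of graphs that contains all connected graphs (for instance, all graphs). The nodes of an $n$-node network $G\in\mathcal G$ carry arbitrary distinct identifiers from $\{1,\dots,N(n)\}$. Initially a node knows $n$, its identifier, its label, and the identifiers of its neighbors. All nodes run the same algorithm, in synchronous rounds of prescribed types, with unrestricted local computation. In a LOCAL round every node sends a bit string of any length to each of its neighbors (possibly different ones to different neighbors); a CONGEST round is the same, but messages have $O(\log n)$ bits; in a BCC (Broadcast Congested Clique) round every node sends one and the same $O(\log n)$-bit message to all other nodes of the network. Every message is received together with the identifier of its sender. After the last round every node accepts or rejects. An algorithm decides a language $\mathcal L$ if, for every labeled graph $(G,\ell)$ with $G\in\mathcal G$ and every assignment of identifiers, $(G,\ell)\in\mathcal L$ if and only if all nodes accept. A randomized algorithm (whose coins may even be shared by all nodes, and whose $O(\log n)$ bandwidth bound holds for all outcomes of the coins, with the same constant) decides $\mathcal L$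 with error $\epsilon$ if, for every such $(G,\ell)$ and identifiers, with probability at least $1-\epsilon$ all nodes accept when $(G,\ell)\in\mathcal L$, and with probability at least $1-\epsilon$ at least one node rejects when $(G,\ell)\notin\mathcal L$. Let $\mathbf{CB}$ be the set of languages decided by a deterministic algorithm performing one CONGEST round followed by one BCC round, and let $\mathbf{BL}^*=\bigcup_{k\ge 0}\mathbf{BL}^k$, where $\mathbf{BL}^k$ is the set of languages decided by a deterministic algorithm performing one BCC round followed by $k$ LOCAL rounds. **Theorem.** Let $$\texttt{one-marked-edge}=\bigl\{(G,\ell): \ell:V(G)\to\{0,1\},\ \bigl|\{\{u,v\}\in E(G):\ell(u)=\ell(v)=1\}\bigr|=1\bigr\}.$$ Then $\texttt{one-marked-edge}\in\mathbf{CB}\smallsetminus\mathbf{BL}^*$; in particular $\mathbf{CB}\smallsetminus\mathbf{BL}^*\neq\varnothing$. Moreover, for every $\epsilon<1/5$ and every $k\ge 0$, no randomized algorithm performing one BCC round followed by $k$ LOCAL rounds decides $\texttt{one-marked-edge}$ with error $\epsilon$. -/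

import Mathlib

open MeasureTheory

namespace HybridModel

/-- The three kinds of communication rounds. -/
inductive RoundKind
  | loc
  | congest
  | bcc

/-- A finite nonempty simple graph with a label in `{0,1}^*` on every vertex. -/
structure LabeledGraph where
  n : ℕ
  pos : 0 < n
  graph : SimpleGraph (Fin n)
  label : Fin n → List Bool

/-- A distributed language is a set of labeled graphs. -/
abbrev DistLanguage := Set LabeledGraph

/-- An assignment of pairwise distinct identifiers in `[1, N]` to the vertices of `X`. -/
structure IdAssignment (X : LabeledGraph) (N : ℕ) where
  id : Fin X.n → ℕ
  injective : Function.Injective id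
  one_le : ∀ v, 1 ≤ id v
  le : ∀ v, id v ≤ N

/-- What a node knows initially: the number of nodes of the network, its own identifier, its own
label, and the identifiers of its neighbors. -/
structure NodeInput where
  size : ℕ
  id : ℕ
  label : List Bool
  nbrIds : Set ℕ

/-- What a node receives in one round: the pairs (identifier of the sender, message). -/
abbrev Inbox := Set (ℕ × List Bool)

/-- A (deterministic) algorithm, run by all nodes. Local computation is unrestricted; messages are
finite bit strings. In a LOCAL or CONGEST round a node sends a message to each of its neighbors,
which may depend on the neighbor (specified by its identifier); in a BCC round it sends one and the
same message to all other nodes. -/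
structure Algorithm where
  State : Type
  init : NodeInput → State
  send : State → ℕ → List Bool
  bcast : State → List Bool
  step : State → Inbox → State
  accept : State → Prop

namespace Algorithm

variable (A : Algorithm) (X : LabeledGraph) {N : ℕ} (I : IdAssignment X N)

/-- The initial states of all nodes. -/
def initStates (v : Fin X.n) : A.State :=
  A.init ⟨X.n, I.id v, X.label v, {i | ∃ u, X.graph.Adj v u ∧ I.id u = i}⟩

/-- The messages received by `v` in a round of the given kind, when the nodes are in states `σ`. -/
def inbox (σ : Fin X.n → A.State) (v : Fin X.n) : RoundKind → Inbox
  | .loc => {p | ∃ u, X.graph.Adj v u ∧ p = (I.id u, A.send (σ u) (I.id v))}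
  | .congest => {p | ∃ u, X.graph.Adj v u ∧ p = (I.id u, A.send (σ u) (I.id v))}
  | .bcc => {p | ∃ u, u ≠ v ∧ p = (I.id u, A.bcast (σ u))}

/-- The states after one round of the given kind. -/
def round (r : RoundKind) (σ : Fin X.n → A.State) (v : Fin X.n) : A.State :=
  A.step (σ v) (A.inbox X I σ v r)

/-- The states after performing, in order, the rounds of a list. -/
def run : List RoundKind → (Fin X.n → A.State) → (Fin X.n → A.State)
  | [], σ => σ
  | r :: rs, σ => run rs (A.round X I r σ)

/-- Every message sent in one round from the states `σ` respects the bandwidth `b`. There is no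
restriction in a LOCAL round. -/
def RoundWithin (b : ℕ) (σ : Fin X.n → A.State) : RoundKind → Prop
  | .loc => True
  | .congest => ∀ v u, X.graph.Adj v u → (A.send (σ v) (I.id u)).length ≤ b
  | .bcc => ∀ v, (A.bcast (σ v)).length ≤ b

/-- Every round of the execution from the states `σ` respects the bandwidth `b`. -/
def RunWithin (b : ℕ) : List RoundKind → (Fin X.n → A.State) → Prop
  | [], _ => True
  | r :: rs, σ => A.RoundWithin X I b σ r ∧ RunWithin b rs (A.round X I r σ)

/-- All nodes accept after performing the rounds of `s`. -/
def AllAccept (s : List RoundKind) : Prop :=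
  ∀ v, A.accept (A.run X I s (A.initStates X I) v)

end Algorithm

/-- A class of graphs: the networks on which algorithms are run. -/
abbrev GraphClass := ∀ n : ℕ, Set (SimpleGraph (Fin n))

/-- All messages of `A` in CONGEST and BCC rounds, on all `n`-node networks of the class, have at
most `c * (⌊log₂ n⌋ + 1)` bits. -/
def LogBandwidth (𝒢 : GraphClass) (N : ℕ → ℕ) (s : List RoundKind) (c : ℕ) (A : Algorithm) : Prop :=
  ∀ (X : LabeledGraph) (I : IdAssignment X (N X.n)), X.graph ∈ 𝒢 X.n →
    A.RunWithin X I (c * (Nat.log 2 X.n + 1)) s (A.initStates X I)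

/-- The distributed languages that can be decided, on networks of the class `𝒢` with identifiers
in `[1, N n]`, by a deterministic algorithm performing in order the rounds of the list `s`, with
messages of `O(log n)` bits in the CONGEST and BCC rounds. -/
def Hybrid (𝒢 : GraphClass) (N : ℕ → ℕ) (s : List RoundKind) : Set DistLanguage :=
  {L | ∃ (A : Algorithm) (c : ℕ), LogBandwidth 𝒢 N s c A ∧
    ∀ (X : LabeledGraph) (I : IdAssignment X (N X.n)), X.graph ∈ 𝒢 X.n →
      (X ∈ L ↔ A.AllAccept X I s)}

/-- The distributed languages that can be decided with error probability at most `ε` by a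
randomized algorithm performing in order the rounds of the list `s`. The outcome `ω` of all coin
tosses is drawn from a probability space, and the nodes then run the algorithm `A ω`. All nodes may
use all of `ω` (shared coins); private coins are the case where `ω` is a family of independent
strings indexed by identifiers and a node uses only the string at its own identifier. -/
def RandHybrid (𝒢 : GraphClass) (N : ℕ → ℕ) (ε : ℝ) (s : List RoundKind) : Set DistLanguage :=
  {L | ∃ (Ω : Type) (_ : MeasurableSpace Ω) (μ : Measure Ω) (_ : IsProbabilityMeasure μ)
      (A : Ω → Algorithm) (c : ℕ), (∀ ω, LogBandwidth 𝒢 N s c (A ω)) ∧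
    ∀ (X : LabeledGraph) (I : IdAssignment X (N X.n)), X.graph ∈ 𝒢 X.n →
      MeasurableSet {ω | (A ω).AllAccept X I s} ∧
      (X ∈ L → 1 - ε ≤ μ.real {ω | (A ω).AllAccept X I s}) ∧
      (X ∉ L → 1 - ε ≤ μ.real {ω | ¬ (A ω).AllAccept X I s})}

/-- The labels are in `{0,1}`, and exactly one edge has both endpoints labeled `1`. -/
def oneMarkedEdge : DistLanguage :=
  {X | (∀ v, X.label v = [false] ∨ X.label v = [true]) ∧
    {e ∈ X.graph.edgeSet | ∀ v ∈ e, X.label v = [true]}.ncard = 1}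

end HybridModel

/-! Upper bound: after the CONGEST round a node knows its marked neighbors, hence whether it is an
endpoint of a marked edge. After these bits are broadcast, an endpoint can check that its only
marked neighbor is the only other endpoint.

Lower bound: two areas, each a random bipartite graph on `m + m` nodes with one random marked pair,
are joined by a path so long that after `k` LOCAL rounds every node is still out of reach of one of
them. About that area it has learned only the labels and the broadcasts, which carry `O(m log m)`
bits on a graph of `m²` random bits. So even when the marked pair is known, whether it is an edge
stays nearly unbiased (`sum_bitSign_mul_indicator_le`).

Rejection is thus a union of two events, each almost uncorrelated with the bit of one area, and this
makes it nearly subadditive (`sum_reject_le`): two marked edges are rejected hardly more often than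
the two single-edge cases together. A correct algorithm must reject the former and accept the
latter. The estimate holds for every outcome of the coins, so it survives integration and rules out
every error below `1/5`. -/

namespace HybridModel

variable {m k : ℕ}

/-! ### Many random bits against a function with few values -/

/-- The sign `1` or `-1` of a bit. -/
def bitSign (b : Bool) : ℝ := if b then 1 else -1

/-- The bits are independent, so the exponential moment factors over `p`; each factor is a
hyperbolic cosine, at most `exp (x ^ 2 / 2)`. -/
theorem sum_exp_signed_sum_le {P : Type*} [Fintype P] [DecidableEq P] (h : P → ℝ)
    (hh : ∀ p, |h p| ≤ 1) (x : ℝ) :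
    ∑ G : P → Bool, Real.exp (x * ∑ p, bitSign (G p) * h p) ≤
      Fintype.card (P → Bool) * Real.exp (x ^ 2 * Fintype.card P / 2) := by
  have h1 : ∀ G : P → Bool, Real.exp (x * ∑ p, bitSign (G p) * h p) =
      ∏ p, Real.exp (x * (bitSign (G p) * h p)) := by
    intro G
    rw [Finset.mul_sum, Real.exp_sum]
  have h2 : ∑ G : P → Bool, ∏ p, Real.exp (x * (bitSign (G p) * h p)) =
      ∏ p, ∑ b : Bool, Real.exp (x * (bitSign b * h p)) := by
    rw [Finset.prod_univ_sum, Fintype.piFinset_univ]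
  rw [Finset.sum_congr rfl fun G _ => h1 G, h2]
  have h3 : ∀ p, ∑ b : Bool, Real.exp (x * (bitSign b * h p)) ≤ 2 * Real.exp (x ^ 2 / 2) := by
    intro p
    have h4 : ∑ b : Bool, Real.exp (x * (bitSign b * h p)) = 2 * Real.cosh (x * h p) := by
      rw [Fintype.sum_bool, Real.cosh_eq]
      simp only [bitSign]
      norm_num
      ring
    rw [h4]
    gcongr
    refine (Real.cosh_le_exp_half_sq _).trans (Real.exp_le_exp.2 ?_)
    have h5 : (h p) ^ 2 ≤ 1 := (sq_le_one_iff_abs_le_one _).2 (hh p)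
    have h6 := mul_le_mul_of_nonneg_left h5 (sq_nonneg x)
    rw [mul_pow]
    linarith
  calc ∏ p, ∑ b : Bool, Real.exp (x * (bitSign b * h p))
      ≤ ∏ _p : P, 2 * Real.exp (x ^ 2 / 2) :=
        Finset.prod_le_prod (fun p _ => Finset.sum_nonneg fun b _ => (Real.exp_pos _).le)
          fun p _ => h3 p
    _ = _ := by
        rw [Finset.prod_const, mul_pow, ← Real.exp_nat_mul, Finset.card_univ]
        simp only [Fintype.card_pi, Fintype.card_bool, Finset.prod_const, Finset.card_univ]
        push_cast
        congr 2
        ring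

/-- Weights that depend on a random bit vector only through a function `F` with few values
correlate little with the bits. -/
theorem sum_signed_sum_le {P T : Type*} [Fintype P] [DecidableEq P] [Fintype T] [Nonempty T]
    (F : (P → Bool) → T) (h : T → P → ℝ) (hh : ∀ t p, |h t p| ≤ 1) {x : ℝ} (hx : 0 < x) :
    ∑ G : P → Bool, ∑ p, bitSign (G p) * h (F G) p ≤
      Fintype.card (P → Bool) *
        ((Real.log (Fintype.card T) + x ^ 2 * Fintype.card P / 2) / x) := by
  -- With this `a`, each fixed `t` contributes at most `1 / |T|` to the average of `exp (x * sum -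
  -- a)`, so all `t` together contribute at most `1`. The inequality `y + 1 ≤ exp y` then plays the
  -- role of Jensen's inequality.
  set a : ℝ := Real.log (Fintype.card T) + x ^ 2 * Fintype.card P / 2 with ha
  have hT : (0 : ℝ) < Fintype.card T := by exact_mod_cast Fintype.card_pos
  have h1 : ∀ G : P → Bool, x * (∑ p, bitSign (G p) * h (F G) p) - a ≤
      ∑ t, Real.exp (x * (∑ p, bitSign (G p) * h t p)) * Real.exp (-a) - 1 := by
    intro G
    have h2 := Real.add_one_le_exp (x * (∑ p, bitSign (G p) * h (F G) p) - a)
    have h3 : Real.exp (x * (∑ p, bitSign (G p) * h (F G) p)) * Real.exp (-a) ≤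
        ∑ t, Real.exp (x * (∑ p, bitSign (G p) * h t p)) * Real.exp (-a) :=
      Finset.single_le_sum (f := fun t =>
        Real.exp (x * (∑ p, bitSign (G p) * h t p)) * Real.exp (-a))
        (fun t _ => by positivity) (Finset.mem_univ (F G))
    rw [← Real.exp_add, ← sub_eq_add_neg] at h3
    linarith
  have h4 : ∑ G : P → Bool, (x * (∑ p, bitSign (G p) * h (F G) p) - a) ≤ 0 := by
    refine (Finset.sum_le_sum fun G _ => h1 G).trans ?_
    rw [Finset.sum_sub_distrib, Finset.sum_comm]
    have h5 : ∀ t, ∑ G : P → Bool, Real.exp (x * (∑ p, bitSign (G p) * h t p)) * Real.exp (-a) ≤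
        Fintype.card (P → Bool) / Fintype.card T := by
      intro t
      rw [← Finset.sum_mul]
      refine (mul_le_mul_of_nonneg_right (sum_exp_signed_sum_le (h t) (hh t) x)
        (Real.exp_pos _).le).trans (le_of_eq ?_)
      rw [mul_assoc, ← Real.exp_add, ha, neg_add, add_comm (-Real.log _), add_neg_cancel_left,
        Real.exp_neg, Real.exp_log hT, div_eq_mul_inv]
    have h6 := Finset.sum_le_sum (s := Finset.univ) fun t _ => h5 t
    rw [Finset.sum_const, Finset.card_univ, nsmul_eq_mul, mul_div_cancel₀ _ hT.ne'] at h6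
    simp only [Finset.sum_const, Finset.card_univ, nsmul_eq_mul, mul_one]
    linarith
  rw [Finset.sum_sub_distrib, ← Finset.mul_sum, Finset.sum_const, Finset.card_univ,
    nsmul_eq_mul] at h4
  rw [← mul_div_assoc, le_div_iff₀ hx]
  linarith

/-! ### Random areas and near-subadditivity of rejection -/

/-- The content of one area: a bipartite graph and a marked pair. -/
abbrev Area (m : ℕ) := (Fin m × Fin m → Bool) × (Fin m × Fin m)

/-- Whether the marked pair is an edge. -/
def Area.bit {m : ℕ} (a : Area m) : Bool := a.1 a.2

/-- Complementing the bipartite graph is an involution that flips the bit. -/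
theorem sum_bitSign_area (m : ℕ) : ∑ a : Area m, bitSign a.bit = 0 := by
  let e : Area m ≃ Area m :=
    { toFun := fun a => (fun q => !a.1 q, a.2)
      invFun := fun a => (fun q => !a.1 q, a.2)
      left_inv := fun a => by simp
      right_inv := fun a => by simp }
  have h := Equiv.sum_comp e fun a => bitSign a.bit
  have h1 : ∀ a, bitSign (Area.bit (e a)) = - bitSign a.bit := by
    intro a
    change bitSign (!a.bit) = _
    cases a.bit <;> simp [bitSign]
  rw [Finset.sum_congr rfl fun a _ => h1 a, Finset.sum_neg_distrib] at h
  linarith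

-- By `hg`, the event depends on the graph only through its code `F`. Its indicator is therefore an
-- admissible weight `h (F G) p` for `sum_signed_sum_le`.
open Classical in
theorem sum_bitSign_mul_indicator_le {m : ℕ} {T : Type*} [Fintype T] [Nonempty T]
    (F : (Fin m × Fin m → Bool) → T) (g : Area m → Prop)
    (hg : ∀ a b : Area m, F a.1 = F b.1 → a.2 = b.2 → g a → g b) {x : ℝ} (hx : 0 < x) :
    ∑ a : Area m, bitSign a.bit * (if g a then 1 else 0) ≤
      Fintype.card (Fin m × Fin m → Bool) *
        ((Real.log (Fintype.card T) + x ^ 2 * (m * m : ℕ) / 2) / x) := by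
  have h1 := sum_signed_sum_le F
    (fun t p => if ∃ G, F G = t ∧ g (G, p) then (1 : ℝ) else 0)
    (fun t p => by split_ifs <;> simp) hx
  rw [Fintype.card_prod, Fintype.card_fin] at h1
  refine le_trans (le_of_eq ?_) h1
  rw [Fintype.sum_prod_type]
  refine Finset.sum_congr rfl fun G _ => Finset.sum_congr rfl fun p _ => ?_
  have h2 : g (G, p) ↔ ∃ G', F G' = F G ∧ g (G', p) :=
    ⟨fun h => ⟨G, rfl, h⟩, fun ⟨G', h, h'⟩ => hg (G', p) (G, p) h rfl h'⟩
  simp only [← h2]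
  rfl

/-- `1` on the areas with bit `b` and `0` on the others. -/
def Area.weight {m : ℕ} (b : Bool) (a : Area m) : ℝ := if a.bit = b then 1 else 0

theorem Area.weight_nonneg {m : ℕ} (b : Bool) (a : Area m) : 0 ≤ a.weight b := by
  unfold Area.weight; split_ifs <;> simp

theorem Area.weight_true_sub_weight_false {m : ℕ} (a : Area m) :
    a.weight true - a.weight false = bitSign a.bit := by
  unfold Area.weight bitSign
  cases a.bit <;> simp

theorem sum_weight (m : ℕ) (b : Bool) :
    ∑ a : Area m, a.weight b = Fintype.card (Area m) / 2 := by
  have h1 : ∑ a : Area m, (a.weight true - a.weight false) = 0 := by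
    simp only [Area.weight_true_sub_weight_false, sum_bitSign_area]
  have h2 : ∑ a : Area m, (a.weight true + a.weight false) = Fintype.card (Area m) := by
    have : ∀ a : Area m, a.weight true + a.weight false = 1 := by
      intro a
      unfold Area.weight
      cases a.bit <;> simp
    simp [this]
  rw [Finset.sum_sub_distrib] at h1
  rw [Finset.sum_add_distrib] at h2
  cases b <;> linarith

open Classical in
/-- If rejection splits into two events, each depending on one of the two areas only through few
values of a function, then rejection is nearly subadditive in the two bits. -/
theorem sum_reject_le {m : ℕ} {η : ℝ} (rej ρ₁ ρ₂ : Area m → Area m → Prop)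
    (h : ∀ a b, rej a b ↔ ρ₁ a b ∨ ρ₂ a b)
    (h₁ : ∀ a, ∑ b : Area m, bitSign b.bit * (if ρ₁ a b then 1 else 0) ≤ η)
    (h₂ : ∀ b, ∑ a : Area m, bitSign a.bit * (if ρ₂ a b then 1 else 0) ≤ η) :
    ∑ a : Area m, ∑ b : Area m, a.weight true * b.weight true * (if rej a b then 1 else 0) ≤
      ∑ a : Area m, ∑ b : Area m, a.weight true * b.weight false * (if rej a b then 1 else 0) +
      ∑ a : Area m, ∑ b : Area m, a.weight false * b.weight true * (if rej a b then 1 else 0) +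
      Fintype.card (Area m) * η := by
  have e₁ : ∑ a : Area m, ∑ b : Area m,
      a.weight true * (bitSign b.bit * (if ρ₁ a b then 1 else 0)) ≤
      Fintype.card (Area m) / 2 * η := by
    rw [← sum_weight m true, Finset.sum_mul]
    refine Finset.sum_le_sum fun a _ => ?_
    rw [← Finset.mul_sum]
    exact mul_le_mul_of_nonneg_left (h₁ a) (a.weight_nonneg _)
  have e₂ : ∑ a : Area m, ∑ b : Area m,
      b.weight true * (bitSign a.bit * (if ρ₂ a b then 1 else 0)) ≤
      Fintype.card (Area m) / 2 * η := by
    rw [← sum_weight m true, Finset.sum_mul, Finset.sum_comm]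
    refine Finset.sum_le_sum fun a _ => ?_
    rw [← Finset.mul_sum]
    exact mul_le_mul_of_nonneg_left (h₂ a) (a.weight_nonneg _)
  -- For bits `(1,1)` this is the union bound. For `(1,0)` and `(0,1)` the sign is `-1`, and the
  -- negative term is absorbed since `ρ₁` and `ρ₂` each imply `rej`. For `(0,0)` all terms vanish.
  have key : ∀ a b : Area m, a.weight true * b.weight true * (if rej a b then (1 : ℝ) else 0) ≤
      a.weight true * b.weight false * (if rej a b then 1 else 0) +
      a.weight false * b.weight true * (if rej a b then 1 else 0) +
      (a.weight true * (bitSign b.bit * (if ρ₁ a b then 1 else 0)) +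
      b.weight true * (bitSign a.bit * (if ρ₂ a b then 1 else 0))) := by
    intro a b
    simp only [h]
    unfold Area.weight bitSign
    by_cases p : ρ₁ a b <;> by_cases q : ρ₂ a b <;> cases a.bit <;> cases b.bit <;> simp [p, q]
  have := Finset.sum_le_sum (s := Finset.univ) fun a _ =>
    Finset.sum_le_sum (s := Finset.univ) fun b _ => key a b
  simp only [Finset.sum_add_distrib] at this
  linarith

/-! ### The networks of the lower bound -/

/-- The nodes: two areas, each with two parts of `m` nodes, and a path of `2 * k + 1` nodes. -/
abbrev TwoAreaVertex (m k : ℕ) := (Bool × Bool × Fin m) ⊕ Fin (2 * k + 1)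

namespace TwoAreaVertex

/-- The position of a node on the line from the first area to the second. -/
def layer : TwoAreaVertex m k → ℕ
  | .inl (false, _, _) => 0
  | .inl (true, _, _) => 2 * k + 2
  | .inr t => t + 1

/-- The distance of a node to the area opposite to `s`. -/
def depth (s : Bool) (v : TwoAreaVertex m k) : ℕ :=
  if s then v.layer else 2 * k + 2 - v.layer

theorem layer_le (v : TwoAreaVertex m k) : v.layer ≤ 2 * k + 2 := by
  rcases v with ⟨s, b, i⟩ | t
  · cases s <;> simp [layer]
  · have := t.2
    simp only [layer]; omega

/-- The two depths sum to `2 * k + 2`. -/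
theorem lt_depth_or (v : TwoAreaVertex m k) : k + 1 ≤ v.depth false ∨ k + 1 ≤ v.depth true := by
  simp only [depth]
  simp
  omega

theorem depth_not (s b : Bool) (i : Fin m) : depth (k := k) s (.inl (!s, b, i)) = 0 := by
  cases s <;> simp [depth, layer]

end TwoAreaVertex

open TwoAreaVertex

/-- Consecutive layers are completely joined, and inside the area `s` the two parts are joined
according to `G s`. -/
def twoAreaGraph (m k : ℕ) (G : Bool → Fin m × Fin m → Bool) :
    SimpleGraph (TwoAreaVertex m k) :=
  SimpleGraph.fromRel fun x y => x.layer + 1 = y.layer ∨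
    ∃ s i j, G s (i, j) = true ∧ x = .inl (s, false, i) ∧ y = .inl (s, true, j)

theorem twoAreaGraph_adj {G : Bool → Fin m × Fin m → Bool} {x y : TwoAreaVertex m k} :
    (twoAreaGraph m k G).Adj x y ↔ x.layer + 1 = y.layer ∨ y.layer + 1 = x.layer ∨
      ∃ s i j, G s (i, j) = true ∧ (x = .inl (s, false, i) ∧ y = .inl (s, true, j) ∨
        y = .inl (s, false, i) ∧ x = .inl (s, true, j)) := by
  rw [twoAreaGraph, SimpleGraph.fromRel_adj]
  constructor
  · rintro ⟨-, (h | ⟨s, i, j, h, h'⟩) | (h | ⟨s, i, j, h, h'⟩)⟩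
    · exact .inl h
    · exact .inr (.inr ⟨s, i, j, h, .inl h'⟩)
    · exact .inr (.inl h)
    · exact .inr (.inr ⟨s, i, j, h, .inr h'⟩)
  · rintro (h | h | ⟨s, i, j, h, h' | h'⟩)
    · refine ⟨?_, .inl (.inl h)⟩
      rintro rfl; omega
    · refine ⟨?_, .inr (.inl h)⟩
      rintro rfl; omega
    · refine ⟨?_, .inl (.inr ⟨s, i, j, h, h'⟩)⟩
      rw [h'.1, h'.2]; simp
    · refine ⟨?_, .inr (.inr ⟨s, i, j, h, h'⟩)⟩
      rw [h'.1, h'.2]; simp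

theorem depth_le_depth_add_one {G : Bool → Fin m × Fin m → Bool} {x y : TwoAreaVertex m k}
    (h : (twoAreaGraph m k G).Adj x y) (s : Bool) : x.depth s ≤ y.depth s + 1 := by
  have hx := x.layer_le
  have hy := y.layer_le
  rcases twoAreaGraph_adj.1 h with h | h | ⟨t, i, j, -, ⟨rfl, rfl⟩ | ⟨rfl, rfl⟩⟩
  · unfold depth; split_ifs <;> omega
  · unfold depth; split_ifs <;> omega
  · cases s <;> cases t <;> simp [depth, layer]
  · cases s <;> cases t <;> simp [depth, layer]

/-- The neighbors of a node are determined by the area it is in. -/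
theorem twoAreaGraph_adj_congr {G G' : Bool → Fin m × Fin m → Bool} {x : TwoAreaVertex m k}
    (h : ∀ s b i, x = .inl (s, b, i) → G s = G' s) (y : TwoAreaVertex m k) :
    (twoAreaGraph m k G).Adj x y ↔ (twoAreaGraph m k G').Adj x y := by
  have key : ∀ {G G' : Bool → Fin m × Fin m → Bool},
      (∀ s b i, x = .inl (s, b, i) → G s = G' s) →
      (twoAreaGraph m k G).Adj x y → (twoAreaGraph m k G').Adj x y := by
    intro G G' h hxy
    rw [twoAreaGraph_adj] at hxy ⊢
    rcases hxy with h' | h' | ⟨t, i, j, h', ⟨h1, h2⟩ | ⟨h1, h2⟩⟩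
    · exact .inl h'
    · exact .inr (.inl h')
    · exact .inr (.inr ⟨t, i, j, h _ _ _ h1 ▸ h', .inl ⟨h1, h2⟩⟩)
    · exact .inr (.inr ⟨t, i, j, h _ _ _ h2 ▸ h', .inr ⟨h1, h2⟩⟩)
  exact ⟨key h, key fun s b i hx => (h s b i hx).symm⟩

/-- Whatever the areas contain, the network must lie in `𝒢`. The path reaches every layer, and each
layer is completely joined to the next. -/
theorem twoAreaGraph_connected (G : Bool → Fin m × Fin m → Bool) :
    (twoAreaGraph m k G).Connected := by
  let root : TwoAreaVertex m k := .inr 0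
  have hr : root.layer = 1 := rfl
  have h1 : ∀ l, ∀ v : TwoAreaVertex m k, v.layer = l + 1 →
      (twoAreaGraph m k G).Reachable root v := by
    intro l
    induction l with
    | zero =>
      intro v hv
      rcases v with ⟨s, b, i⟩ | t
      · cases s <;> simp [layer] at hv
      · have : t = 0 := by
          apply Fin.ext
          simpa [layer] using hv
        rw [this]
    | succ l ih =>
      intro v hv
      have hl := v.layer_le
      let u : TwoAreaVertex m k := .inr ⟨l, by omega⟩
      have hu : u.layer = l + 1 := rfl
      refine (ih u hu).trans (SimpleGraph.Adj.reachable ?_)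
      rw [twoAreaGraph_adj]
      left; omega
  have h2 : ∀ v, (twoAreaGraph m k G).Reachable root v := by
    intro v
    rcases Nat.eq_zero_or_pos v.layer with h | h
    · refine SimpleGraph.Adj.reachable ?_
      rw [twoAreaGraph_adj]
      right; left; omega
    · exact h1 (v.layer - 1) v (by omega)
  rw [SimpleGraph.connected_iff_exists_forall_reachable]
  exact ⟨root, h2⟩

/-- In each area, exactly the two nodes of the marked pair are labeled `1`. -/
def twoAreaLabel (a : Bool → Area m) : TwoAreaVertex m k → List Bool
  | .inl (s, b, i) => [decide (i = if b then (a s).2.2 else (a s).2.1)]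
  | .inr _ => [false]

/-- An enumeration of the nodes. -/
noncomputable def twoAreaEquiv (m k : ℕ) :
    TwoAreaVertex m k ≃ Fin (Fintype.card (TwoAreaVertex m k)) :=
  Fintype.equivFin _

theorem card_twoAreaVertex (m k : ℕ) :
    Fintype.card (TwoAreaVertex m k) = 4 * m + (2 * k + 1) := by
  simp
  ring

/-- The network with areas `a false` and `a true`. -/
noncomputable def twoAreaNetwork (k : ℕ) (a : Bool → Area m) : LabeledGraph where
  n := Fintype.card (TwoAreaVertex m k)
  pos := by rw [card_twoAreaVertex]; omega
  graph := (twoAreaGraph m k fun s => (a s).1).comap (twoAreaEquiv m k).symm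
  label v := twoAreaLabel a ((twoAreaEquiv m k).symm v)

theorem twoAreaNetwork_connected (a : Bool → Area m) :
    (twoAreaNetwork k a).graph.Connected :=
  (SimpleGraph.Iso.connected_iff (SimpleGraph.Iso.comap (twoAreaEquiv m k).symm _)).2
    (twoAreaGraph_connected _)

/-- The identifiers `1, …, n`. -/
def stdIds (X : LabeledGraph) {N : ℕ} (h : X.n ≤ N) : IdAssignment X N where
  id v := v + 1
  injective v w h := Fin.ext (by simpa using h)
  one_le v := by omega
  le v := by have := v.2; omega

/-- The marked pair of an area, as a pair of nodes. -/
noncomputable def markedPair (k : ℕ) (a : Bool → Area m) (s : Bool) :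
    Sym2 (Fin (Fintype.card (TwoAreaVertex m k))) :=
  s(twoAreaEquiv m k (.inl (s, false, (a s).2.1)), twoAreaEquiv m k (.inl (s, true, (a s).2.2)))

theorem markedPair_injective (a : Bool → Area m) : Function.Injective (markedPair k a) := by
  intro s t h
  unfold markedPair at h
  rw [Sym2.eq_iff] at h
  simp at h
  exact h.1.1

/-- Path nodes are unmarked and the layers `0` and `2 * k + 2` of the areas are not consecutive, so
a marked edge lies inside one area, where it can only be the marked pair. -/
theorem markedEdges_twoAreaNetwork (a : Bool → Area m) :
    {e ∈ ((twoAreaGraph m k fun s => (a s).1).comap (twoAreaEquiv m k).symm).edgeSet |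
        ∀ v ∈ e, twoAreaLabel a ((twoAreaEquiv m k).symm v) = [true]} =
      markedPair k a '' {s | (a s).bit = true} := by
  have hlab : ∀ v : TwoAreaVertex m k, twoAreaLabel a v = [true] →
      ∃ s b, v = .inl (s, b, if b then (a s).2.2 else (a s).2.1) := by
    rintro (⟨s, b, i⟩ | t) h
    · exact ⟨s, b, by simpa [twoAreaLabel] using h⟩
    · simp [twoAreaLabel] at h
  ext e
  induction e with | _ x y
  obtain ⟨x, rfl⟩ := (twoAreaEquiv m k).surjective x
  obtain ⟨y, rfl⟩ := (twoAreaEquiv m k).surjective y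
  constructor
  · rintro ⟨hadj, hl⟩
    have hadj' : (twoAreaGraph m k fun s => (a s).1).Adj x y := by
      simpa using hadj
    have hx : twoAreaLabel a x = [true] := by
      simpa using hl _ (Sym2.mem_mk_left _ _)
    have hy : twoAreaLabel a y = [true] := by
      simpa using hl _ (Sym2.mem_mk_right _ _)
    obtain ⟨s, b, hx'⟩ := hlab x hx
    obtain ⟨t, c, hy'⟩ := hlab y hy
    rcases twoAreaGraph_adj.1 hadj' with h | h | ⟨u, i, j, h, ⟨h1, h2⟩ | ⟨h1, h2⟩⟩
    · rw [hx', hy'] at h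
      cases s <;> cases t <;> simp [layer] at h
    · rw [hx', hy'] at h
      cases s <;> cases t <;> simp [layer] at h
    · rw [h1] at hx
      rw [h2] at hy
      simp [twoAreaLabel] at hx hy
      subst hx hy
      exact ⟨u, h, by rw [h1, h2]; rfl⟩
    · rw [h1] at hy
      rw [h2] at hx
      simp [twoAreaLabel] at hx hy
      subst hx hy
      exact ⟨u, h, by rw [h1, h2, Sym2.eq_swap]; rfl⟩
  · rintro ⟨s, hs, h⟩
    rw [← h]
    constructor
    · simp only [markedPair, SimpleGraph.mem_edgeSet, SimpleGraph.comap_adj,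
        Equiv.symm_apply_apply]
      rw [twoAreaGraph_adj]
      exact .inr (.inr ⟨s, _, _, hs, .inl ⟨rfl, rfl⟩⟩)
    · intro v hv
      rcases Sym2.mem_iff.1 hv with rfl | rfl <;> simp [twoAreaLabel]

theorem twoAreaNetwork_mem_oneMarkedEdge {a : Bool → Area m} :
    twoAreaNetwork k a ∈ oneMarkedEdge ↔ (a false).bit ≠ (a true).bit := by
  have hl : ∀ v, (twoAreaNetwork k a).label v = [false] ∨
      (twoAreaNetwork k a).label v = [true] := by
    intro v
    simp only [twoAreaNetwork]
    rcases (twoAreaEquiv m k).symm v with ⟨s, b, i⟩ | t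
    · simp only [twoAreaLabel]
      cases decide (i = if b then (a s).2.2 else (a s).2.1) <;> simp
    · simp [twoAreaLabel]
  have : twoAreaNetwork k a ∈ oneMarkedEdge ↔
      {e ∈ ((twoAreaGraph m k fun s => (a s).1).comap (twoAreaEquiv m k).symm).edgeSet |
        ∀ v ∈ e, twoAreaLabel a ((twoAreaEquiv m k).symm v) = [true]}.ncard = 1 :=
    and_iff_right hl
  rw [this, markedEdges_twoAreaNetwork, Set.ncard_image_of_injective _ (markedPair_injective a)]
  have h2 : {s | (a s).bit = true}.ncard =
      (Finset.univ.filter fun s => (a s).bit = true).card := by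
    rw [← Set.ncard_coe_finset]; simp
  rw [h2, Finset.card_filter, Fintype.sum_bool]
  cases (a false).bit <;> cases (a true).bit <;> simp

/-! ### Locality -/

/-- After `j` LOCAL rounds, differences have spread by at most `j` levels of `d`. -/
theorem run_loc_congr (A : Algorithm) {n : ℕ} {pos : 0 < n} {G G' : SimpleGraph (Fin n)}
    {l l' : Fin n → List Bool} {N N' : ℕ} (I : IdAssignment ⟨n, pos, G, l⟩ N)
    (I' : IdAssignment ⟨n, pos, G', l'⟩ N') (hI : ∀ v : Fin n, I.id v = I'.id v) (d : Fin n → ℕ)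
    (hd : ∀ v u, G.Adj v u → d v ≤ d u + 1)
    (hG : ∀ v, 1 ≤ d v → ∀ u, G.Adj v u ↔ G'.Adj v u) (j t : ℕ) (ht : 1 ≤ t)
    (σ σ' : Fin n → A.State) (hσ : ∀ v, t ≤ d v → σ v = σ' v) (v : Fin n) (hv : t + j ≤ d v) :
    A.run ⟨n, pos, G, l⟩ I (List.replicate j .loc) σ v =
      A.run ⟨n, pos, G', l'⟩ I' (List.replicate j .loc) σ' v := by
  induction j generalizing t σ σ' with
  | zero => exact hσ v hv
  | succ j ih =>
    -- The first round is peeled off. A node of level at least `t + 1` hears only from levels at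
    -- least `t`, where the states agree; its neighborhood is the same in both graphs because its
    -- level is positive.
    refine ih (t + 1) (by omega) _ _ ?_ (by omega)
    intro w hw
    have h1 : A.inbox ⟨n, pos, G, l⟩ I σ w .loc = A.inbox ⟨n, pos, G', l'⟩ I' σ' w .loc := by
      ext p
      constructor
      · rintro ⟨u, hu, rfl⟩
        have := hd w u hu
        exact ⟨u, (hG w (by omega) u).1 hu, by rw [hI, hI, hσ u (by omega)]⟩
      · rintro ⟨u, hu, rfl⟩
        have hu' := (hG w (by omega) u).2 hu
        have := hd w u hu'
        exact ⟨u, hu', by rw [hI, hI, hσ u (by omega)]⟩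
    change A.step (σ w) _ = A.step (σ' w) _
    rw [h1, hσ w (by omega)]

/-- Equal broadcasts everywhere and equal inputs from level `1` on give equal states from level `1`
on after the BCC round; the LOCAL rounds then cost `k` levels. -/
theorem run_bcc_loc_congr (A : Algorithm) {n : ℕ} {pos : 0 < n} {G G' : SimpleGraph (Fin n)}
    {l l' : Fin n → List Bool} {N N' : ℕ} (I : IdAssignment ⟨n, pos, G, l⟩ N)
    (I' : IdAssignment ⟨n, pos, G', l'⟩ N') (hI : ∀ v : Fin n, I.id v = I'.id v) (d : Fin n → ℕ)
    (hd : ∀ v u, G.Adj v u → d v ≤ d u + 1)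
    (hG : ∀ v, 1 ≤ d v → ∀ u, G.Adj v u ↔ G'.Adj v u) (hl : ∀ v, 1 ≤ d v → l v = l' v)
    (hb : ∀ v, A.bcast (A.initStates ⟨n, pos, G, l⟩ I v) =
      A.bcast (A.initStates ⟨n, pos, G', l'⟩ I' v)) (k : ℕ) (v : Fin n) (hv : k + 1 ≤ d v) :
    A.run ⟨n, pos, G, l⟩ I (.bcc :: List.replicate k .loc) (A.initStates _ I) v =
      A.run ⟨n, pos, G', l'⟩ I' (.bcc :: List.replicate k .loc) (A.initStates _ I') v := by
  refine run_loc_congr A I I' hI d hd hG k 1 le_rfl _ _ ?_ v (by omega)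
  intro w hw
  have h1 : A.initStates ⟨n, pos, G, l⟩ I w = A.initStates ⟨n, pos, G', l'⟩ I' w := by
    simp only [Algorithm.initStates, hI, hl w hw, hG w hw]
  have h2 : A.inbox ⟨n, pos, G, l⟩ I (A.initStates _ I) w .bcc =
      A.inbox ⟨n, pos, G', l'⟩ I' (A.initStates _ I') w .bcc := by
    simp only [Algorithm.inbox, hI, hb]
  change A.step _ _ = A.step _ _
  rw [h1, h2]

/-! ### What broadcasts reveal about the opposite area -/

/-- The initial knowledge of a node of `twoAreaGraph m k G` with a given label. -/
noncomputable def twoAreaInput (k : ℕ) (G : Bool → Fin m × Fin m → Bool) (lab : List Bool)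
    (v : TwoAreaVertex m k) : NodeInput where
  size := Fintype.card (TwoAreaVertex m k)
  id := (twoAreaEquiv m k v).val + 1
  label := lab
  nbrIds := {i | ∃ u, (twoAreaGraph m k G).Adj v u ∧ (twoAreaEquiv m k u).val + 1 = i}

theorem initStates_twoAreaNetwork (A : Algorithm) (a : Bool → Area m) {N : ℕ}
    (h : (twoAreaNetwork k a).n ≤ N) (v : TwoAreaVertex m k) :
    A.initStates (twoAreaNetwork k a) (stdIds _ h) (twoAreaEquiv m k v) =
      A.init (twoAreaInput k (fun s => (a s).1) (twoAreaLabel a v) v) := by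
  have h1 : (twoAreaNetwork k a).label (twoAreaEquiv m k v) = twoAreaLabel a v :=
    congrArg (twoAreaLabel a) ((twoAreaEquiv m k).symm_apply_apply v)
  have h2 : {i | ∃ u, (twoAreaNetwork k a).graph.Adj (twoAreaEquiv m k v) u ∧
      (stdIds (twoAreaNetwork k a) h).id u = i} = {i | ∃ u, (twoAreaGraph m k
      fun s => (a s).1).Adj v u ∧ (twoAreaEquiv m k u).val + 1 = i} := by
    ext i
    constructor
    · rintro ⟨u, hu, rfl⟩
      refine ⟨(twoAreaEquiv m k).symm u, ?_, congrArg (fun x : Fin _ => x.val + 1)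
        ((twoAreaEquiv m k).apply_symm_apply u)⟩
      have := SimpleGraph.comap_adj.1 hu
      rwa [Equiv.symm_apply_apply] at this
    · rintro ⟨u, hu, rfl⟩
      refine ⟨twoAreaEquiv m k u, ?_, rfl⟩
      refine SimpleGraph.comap_adj.2 ?_
      rwa [Equiv.symm_apply_apply, Equiv.symm_apply_apply]
  unfold Algorithm.initStates
  rw [h1, h2]
  rfl

/-- The messages that the nodes of area `s` with content `g` may broadcast, if all of them have at
most `b` bits. -/
noncomputable def broadcastCode (A : Algorithm) (k b : ℕ) (s : Bool) (g : Fin m × Fin m → Bool) :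
    Bool × Fin m × Bool → Fin b → Option Bool :=
  fun p j => (A.bcast (A.init (twoAreaInput k (fun _ => g) [p.2.2] (.inl (s, p.1, p.2.1)))))[j.val]?

/-- Decodes `broadcastCode`: `none` marks the positions past the end, so `b` entries determine a
message within the bandwidth. -/
theorem list_eq_of_getElem?_eq {α : Type*} {l l' : List α} {b : ℕ} (hl : l.length ≤ b)
    (hl' : l'.length ≤ b) (h : ∀ j : Fin b, l[j.val]? = l'[j.val]?) : l = l' := by
  apply List.ext_getElem?
  intro i
  by_cases hi : i < b
  · exact h ⟨i, hi⟩
  · rw [List.getElem?_eq_none (by omega), List.getElem?_eq_none (by omega)]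

theorem twoAreaInput_congr {G G' : Bool → Fin m × Fin m → Bool} {v : TwoAreaVertex m k}
    (h : ∀ s b i, v = .inl (s, b, i) → G s = G' s) (lab : List Bool) :
    twoAreaInput k G lab v = twoAreaInput k G' lab v := by
  unfold twoAreaInput
  simp only [twoAreaGraph_adj_congr h]

theorem twoAreaLabel_congr {a a' : Bool → Area m} {v : TwoAreaVertex m k}
    (h : ∀ s b i, v = .inl (s, b, i) → (a s).2 = (a' s).2) :
    twoAreaLabel a v = twoAreaLabel a' v := by
  rcases v with ⟨s, b, i⟩ | t
  · simp only [twoAreaLabel, h s b i rfl]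
  · rfl

/-- Some node far from the area opposite to `s` rejects. -/
def RejectsNear (A : Algorithm) (k : ℕ) {N : ℕ → ℕ} (hN : ∀ n, n ≤ N n) (s : Bool)
    (a : Bool → Area m) : Prop :=
  ∃ v : TwoAreaVertex m k, k + 1 ≤ v.depth s ∧
    ¬ A.accept (A.run (twoAreaNetwork k a) (stdIds _ (hN _)) (.bcc :: List.replicate k .loc)
      (A.initStates _ (stdIds _ (hN _))) (twoAreaEquiv m k v))

theorem not_allAccept_iff_rejectsNear (A : Algorithm) {N : ℕ → ℕ} (hN : ∀ n, n ≤ N n)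
    (a : Bool → Area m) :
    ¬ A.AllAccept (twoAreaNetwork k a) (stdIds _ (hN _)) (.bcc :: List.replicate k .loc) ↔
      RejectsNear A k hN false a ∨ RejectsNear A k hN true a := by
  unfold Algorithm.AllAccept RejectsNear
  rw [not_forall]
  constructor
  · rintro ⟨v, hv⟩
    obtain ⟨v, rfl⟩ := (twoAreaEquiv m k).surjective v
    exact v.lt_depth_or.imp (fun h => ⟨v, h, hv⟩) fun h => ⟨v, h, hv⟩
  · rintro (⟨v, -, hv⟩ | ⟨v, -, hv⟩) <;> exact ⟨_, hv⟩

/-- Nodes near area `s` know the opposite area only through the broadcast messages. -/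
theorem RejectsNear.congr {A : Algorithm} {𝒢 : GraphClass} {N : ℕ → ℕ} {hN : ∀ n, n ≤ N n}
    (h𝒢 : ∀ (n : ℕ) (G : SimpleGraph (Fin n)), G.Connected → G ∈ 𝒢 n) {c : ℕ}
    (hA : LogBandwidth 𝒢 N (.bcc :: List.replicate k .loc) c A) {s : Bool}
    {a a' : Bool → Area m} (hs : a s = a' s) (hp : (a !s).2 = (a' !s).2)
    (hc : broadcastCode A k (c * (Nat.log 2 (Fintype.card (TwoAreaVertex m k)) + 1)) (!s) (a !s).1 =
      broadcastCode A k (c * (Nat.log 2 (Fintype.card (TwoAreaVertex m k)) + 1)) (!s) (a' !s).1)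
    (h : RejectsNear A k hN s a) : RejectsNear A k hN s a' := by
  obtain ⟨v, hv, hrej⟩ := h
  have hside : ∀ v : TwoAreaVertex m k, 1 ≤ v.depth s → ∀ t b i, v = .inl (t, b, i) → a t = a' t := by
    rintro v hv t b i rfl
    by_cases ht : t = s
    · rw [ht, hs]
    · rw [Bool.eq_not_of_ne ht, depth_not] at hv
      omega
  have hlabel : ∀ v : TwoAreaVertex m k, twoAreaLabel a v = twoAreaLabel a' v := by
    intro v
    apply twoAreaLabel_congr
    intro t b i _
    by_cases ht : t = s
    · rw [ht, hs]
    · rw [Bool.eq_not_of_ne ht, hp]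
  have hbcast : ∀ v : Fin (Fintype.card (TwoAreaVertex m k)),
      A.bcast (A.initStates (twoAreaNetwork k a) (stdIds _ (hN _)) v) =
      A.bcast (A.initStates (twoAreaNetwork k a') (stdIds _ (hN _)) v) := by
    intro v
    obtain ⟨v, rfl⟩ := (twoAreaEquiv m k).surjective v
    have hlen := fun a => (hA (twoAreaNetwork k a) (stdIds _ (hN _))
      (h𝒢 _ _ (twoAreaNetwork_connected a))).1 (twoAreaEquiv m k v)
    have hl := hlen a
    have hl' := hlen a'
    rw [initStates_twoAreaNetwork] at hl hl' ⊢
    rw [initStates_twoAreaNetwork]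
    rw [← hlabel] at hl' ⊢
    -- A node outside the opposite area has the same input in both networks. A node inside it has
    -- the same label in both, and the code entry for that label determines its message. Since the
    -- code lists the messages for both labels, it does not depend on the marked pair.
    by_cases hd : 1 ≤ v.depth s
    · rw [twoAreaInput_congr (G' := fun s => (a' s).1)
        fun t b i hv => by rw [hside v hd t b i hv]]
    · rcases v with ⟨t, b, i⟩ | t
      · have ht : t = !s := by
          cases s <;> cases t <;> simp [depth, layer] at hd ⊢
        subst ht
        have hG : ∀ (a : Bool → Area m) lab, twoAreaInput k (fun s => (a s).1) lab
            (.inl (!s, b, i)) = twoAreaInput k (fun _ => (a !s).1) lab (.inl (!s, b, i)) := by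
          intro a lab
          apply twoAreaInput_congr
          rintro t _ _ h
          have := (Prod.ext_iff.1 (Sum.inl.inj h)).1
          simp only at this
          rw [this]
        rw [hG a] at hl ⊢
        rw [hG a'] at hl' ⊢
        refine list_eq_of_getElem?_eq hl hl' fun j => ?_
        exact congrFun (congrFun hc (b, i, _)) j
      · have := t.2
        cases s <;> simp [depth, layer] at hd
        omega
  refine ⟨v, hv, ?_⟩
  have key := run_bcc_loc_congr A (stdIds (twoAreaNetwork k a) (hN _))
    (stdIds (twoAreaNetwork k a') (hN _)) (fun _ => rfl)
    (fun v => ((twoAreaEquiv m k).symm v).depth s)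
    (fun v u huv => depth_le_depth_add_one (SimpleGraph.comap_adj.1 huv) s)
    (fun v hv u => twoAreaGraph_adj_congr
      (fun t b i h => by rw [hside _ hv t b i h]) _)
    (fun v _ => hlabel _) hbcast k (twoAreaEquiv m k v)
    (by rwa [Equiv.symm_apply_apply])
  exact fun hacc => hrej ((congrArg A.accept key).mpr hacc)

/-! ### Choice of parameters and the deterministic estimate -/

/-- Some area size is large compared to the bandwidth. -/
theorem exists_bandwidth_le (c k : ℕ) :
    ∃ m, 0 < m ∧ 1600 * (c * (Nat.log 2 (Fintype.card (TwoAreaVertex m k)) + 1)) ≤ m := by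
  -- For `m = 2 ^ s` there are fewer than `2 ^ (s + (2 * k + 3))` nodes, so the bandwidth grows
  -- linearly in `s` while `m` grows exponentially.
  obtain ⟨s, hs⟩ : ∃ s : ℕ, 1600 * (c * (s + (2 * k + 4))) ≤ 2 ^ s := by
    have h := tendsto_pow_const_div_const_pow_of_one_lt 1 (one_lt_two (α := ℝ))
    have h0 := tendsto_pow_const_div_const_pow_of_one_lt 0 (one_lt_two (α := ℝ))
    have h1 : Filter.Tendsto (fun s : ℕ => (1600 * c : ℝ) * ((s : ℝ) ^ 1 / 2 ^ s) +
        (1600 * c * (2 * k + 4) : ℝ) * ((s : ℝ) ^ 0 / 2 ^ s)) Filter.atTop (nhds 0) := by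
      simpa using (h.const_mul (1600 * c : ℝ)).add (h0.const_mul (1600 * c * (2 * k + 4) : ℝ))
    obtain ⟨s, hs⟩ := (h1.eventually (eventually_le_nhds (one_pos))).exists
    refine ⟨s, ?_⟩
    have h2 : (0 : ℝ) < 2 ^ s := by positivity
    have h3 : (1600 * (c * (s + (2 * k + 4))) : ℝ) / 2 ^ s ≤ 1 := by
      refine le_trans (le_of_eq ?_) hs
      ring
    rw [div_le_one h2] at h3
    exact_mod_cast h3
  refine ⟨2 ^ s, by positivity, le_trans ?_ hs⟩
  refine Nat.mul_le_mul_left _ (Nat.mul_le_mul_left _ ?_)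
  have h1 : Fintype.card (TwoAreaVertex (2 ^ s) k) < 2 ^ (s + (2 * k + 3)) := by
    rw [card_twoAreaVertex, pow_add]
    have h2 : 1 ≤ 2 ^ s := Nat.one_le_two_pow
    have h3 : 2 * k + 3 < 2 ^ (2 * k + 3) := Nat.lt_two_pow_self
    have h4 : 2 ^ (2 * k + 3) = 8 * 2 ^ (2 * k) := by ring
    have h5 : 2 * k < 2 ^ (2 * k) := Nat.lt_two_pow_self
    rw [h4]
    nlinarith
  have := Nat.log_lt_of_lt_pow (by rw [card_twoAreaVertex]; omega) h1
  omega

/-- A code has one of three symbols for each of the `2 * m` nodes of an area, each of two labels and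
each of `b` positions; `log 3` is bounded crudely by `2`. -/
theorem log_card_code_le (m b : ℕ) :
    Real.log (Fintype.card (Bool × Fin m × Bool → Fin b → Option Bool)) ≤ 8 * m * b := by
  have h1 : Fintype.card (Bool × Fin m × Bool → Fin b → Option Bool) = 3 ^ (b * (4 * m)) := by
    simp
    rw [← pow_mul]
    congr 1
    ring
  rw [h1]
  push_cast
  rw [Real.log_pow]
  have h2 : Real.log 3 ≤ 2 := by
    have := Real.log_le_sub_one_of_pos (show (0 : ℝ) < 3 by norm_num)
    linarith
  push_cast
  have h3 : (0 : ℝ) ≤ b * (4 * m) := by positivity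
  nlinarith

open Classical in
/-- A deterministic algorithm rejects two marked edges hardly more often than one. -/
theorem sum_not_allAccept_le {A : Algorithm} {𝒢 : GraphClass} {N : ℕ → ℕ} (hN : ∀ n, n ≤ N n)
    (h𝒢 : ∀ (n : ℕ) (G : SimpleGraph (Fin n)), G.Connected → G ∈ 𝒢 n) {c : ℕ}
    (hA : LogBandwidth 𝒢 N (.bcc :: List.replicate k .loc) c A) (hm : 0 < m)
    (hmc : 1600 * (c * (Nat.log 2 (Fintype.card (TwoAreaVertex m k)) + 1)) ≤ m)
    (R : Area m → Area m → Prop)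
    (hR : ∀ a b, R a b ↔ ¬ A.AllAccept (twoAreaNetwork k fun s => bif s then b else a)
      (stdIds _ (hN _)) (.bcc :: List.replicate k .loc)) :
    ∑ a : Area m, ∑ b : Area m, a.weight true * b.weight true * (if R a b then 1 else 0) ≤
      ∑ a : Area m, ∑ b : Area m, a.weight true * b.weight false * (if R a b then 1 else 0) +
      ∑ a : Area m, ∑ b : Area m, a.weight false * b.weight true * (if R a b then 1 else 0) +
      (Fintype.card (Area m) : ℝ) ^ 2 / 10 := by
  set B := c * (Nat.log 2 (Fintype.card (TwoAreaVertex m k)) + 1) with hB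
  -- Here `x = 1 / 10`. Since `B ≤ m / 1600`, the logarithm is at most `8 * m * B ≤ m² / 200`, which
  -- balances `x² * m² / 2 = m² / 200`. Dividing the sum by `x` gives `m² / 10`.
  have hη : (Fintype.card (Fin m × Fin m → Bool) : ℝ) *
      ((Real.log (Fintype.card (Bool × Fin m × Bool → Fin B → Option Bool)) +
        (1 / 10) ^ 2 * (m * m : ℕ) / 2) / (1 / 10)) ≤ Fintype.card (Area m) / 10 := by
    have h1 := log_card_code_le m B
    have h2 : (1600 * B : ℝ) ≤ m := by exact_mod_cast hmc
    have h3 : (0 : ℝ) ≤ m := by positivity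
    have h4 : (Fintype.card (Area m) : ℝ) =
        Fintype.card (Fin m × Fin m → Bool) * (m * m) := by
      rw [Fintype.card_prod, Fintype.card_prod (Fin m) (Fin m), Fintype.card_fin]
      push_cast; ring
    rw [h4, mul_div_assoc (Fintype.card (Fin m × Fin m → Bool) : ℝ) (m * m : ℝ)]
    refine mul_le_mul_of_nonneg_left ?_ (by positivity)
    have h5 := mul_le_mul_of_nonneg_left h2 h3
    push_cast
    rw [div_le_iff₀ (by norm_num)]
    linarith
  have h := sum_reject_le R
    (fun a b => RejectsNear A k hN false fun s => bif s then b else a)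
    (fun a b => RejectsNear A k hN true fun s => bif s then b else a)
    (η := Fintype.card (Area m) / 10)
    (fun a b => by rw [hR, not_allAccept_iff_rejectsNear])
    (fun a => (sum_bitSign_mul_indicator_le (broadcastCode A k B true) _
      (fun b b' hc hp => RejectsNear.congr h𝒢 hA rfl hp hc)
      (by norm_num : (0 : ℝ) < 1 / 10)).trans hη)
    (fun b => (sum_bitSign_mul_indicator_le (broadcastCode A k B false) _
      (fun a a' hc hp => RejectsNear.congr h𝒢 hA rfl hp hc)
      (by norm_num : (0 : ℝ) < 1 / 10)).trans hη)
  refine h.trans (le_of_eq ?_)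
  ring

/-! ### Averaging over the coins -/

theorem integral_le_add_add_const {Ω : Type*} [MeasurableSpace Ω] {μ : Measure Ω}
    [IsProbabilityMeasure μ] {f g h : Ω → ℝ} {C : ℝ} (hf : Integrable f μ) (hg : Integrable g μ)
    (hh : Integrable h μ) (hle : ∀ ω, f ω ≤ g ω + h ω + C) :
    ∫ ω, f ω ∂μ ≤ ∫ ω, g ω ∂μ + ∫ ω, h ω ∂μ + C := by
  refine (integral_mono hf ((hg.add hh).add (integrable_const C)) hle).trans (le_of_eq ?_)
  rw [integral_add' (hg.add hh) (integrable_const C), integral_add' hg hh]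
  simp

theorem oneMarkedEdge_notMem_randHybrid {𝒢 : GraphClass} {N : ℕ → ℕ} (hN : ∀ n, n ≤ N n)
    (h𝒢 : ∀ (n : ℕ) (G : SimpleGraph (Fin n)), G.Connected → G ∈ 𝒢 n) {ε : ℝ} (hε : ε < 1 / 5)
    (k : ℕ) : oneMarkedEdge ∉ RandHybrid 𝒢 N ε (.bcc :: List.replicate k .loc) := by
  classical
  rintro ⟨Ω, _, μ, _, A, c, hA, hdec⟩
  -- The constant `c` is the same for all outcomes of the coins, so one `m` serves every `A ω`.
  obtain ⟨m, hm, hmc⟩ := exists_bandwidth_le c k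
  let net : Area m → Area m → LabeledGraph := fun a b => twoAreaNetwork k fun s => bif s then b else a
  let acc : Area m → Area m → Set Ω := fun a b =>
    {ω | (A ω).AllAccept (net a b) (stdIds _ (hN _)) (.bcc :: List.replicate k .loc)}
  have hd := fun a b => hdec (net a b) (stdIds _ (hN _))
    (h𝒢 _ _ (twoAreaNetwork_connected _))
  have hmeas : ∀ a b, MeasurableSet (acc a b) := fun a b => (hd a b).1
  let r : Area m → Area m → ℝ := fun a b => μ.real (acc a b)ᶜ
  have hr0 : ∀ a b, 1 - r a b = μ.real (acc a b) := by
    intro a b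
    have := probReal_compl_eq_one_sub (μ := μ) (hmeas a b)
    simp only [r]; linarith
  have hin : ∀ a b : Area m, a.bit ≠ b.bit → r a b ≤ ε := by
    intro a b h
    have h1 := (hd a b).2.1 (twoAreaNetwork_mem_oneMarkedEdge.2 h)
    have h2 := hr0 a b
    change 1 - ε ≤ μ.real (acc a b) at h1
    linarith
  have hout : ∀ a b : Area m, a.bit = b.bit → 1 - ε ≤ r a b := by
    intro a b h
    exact (hd a b).2.2 fun h' => twoAreaNetwork_mem_oneMarkedEdge.1 h' h
  let S : Bool → Bool → (Area m → Area m → ℝ) → ℝ := fun x y f =>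
    ∑ a : Area m, ∑ b : Area m, a.weight x * b.weight y * f a b
  have hint : ∀ x y, Integrable (fun ω => S x y fun a b => if ω ∈ (acc a b)ᶜ then 1 else 0) μ ∧
      ∫ ω, (S x y fun a b => if ω ∈ (acc a b)ᶜ then 1 else 0) ∂μ = S x y r := by
    intro x y
    have h1 : ∀ a b, Integrable (fun ω => if ω ∈ (acc a b)ᶜ then (1 : ℝ) else 0) μ := by
      intro a b
      refine ((integrable_const (1 : ℝ)).indicator (hmeas a b).compl).congr (.of_forall fun ω => ?_)
      simp only [Set.indicator_apply]
    have h2 : ∀ a b, ∫ ω, (if ω ∈ (acc a b)ᶜ then (1 : ℝ) else 0) ∂μ = r a b := by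
      intro a b
      refine Eq.trans (integral_congr_ae (.of_forall fun ω => ?_))
        (integral_indicator_one (hmeas a b).compl)
      simp only [Set.indicator_apply, Pi.one_apply]
    refine ⟨integrable_finsetSum _ fun a _ => integrable_finsetSum _ fun b _ =>
      (h1 a b).const_mul _, ?_⟩
    simp only [S]
    rw [integral_finsetSum _ fun a _ => integrable_finsetSum _ fun b _ => (h1 a b).const_mul _]
    refine Finset.sum_congr rfl fun a _ => ?_
    rw [integral_finsetSum _ fun b _ => (h1 a b).const_mul _]
    refine Finset.sum_congr rfl fun b _ => ?_
    rw [integral_const_mul, h2]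
  have hmain : S true true r ≤ S true false r + S false true r +
      (Fintype.card (Area m) : ℝ) ^ 2 / 10 := by
    rw [← (hint true true).2, ← (hint true false).2, ← (hint false true).2]
    exact integral_le_add_add_const (hint true true).1 (hint true false).1 (hint false true).1
      fun ω => by
        convert sum_not_allAccept_le hN h𝒢 (hA ω) hm hmc (fun a b => ω ∈ (acc a b)ᶜ)
          fun a b => Iff.rfl
  have hconst : ∀ x y (t : ℝ), S x y (fun _ _ => t) = (Fintype.card (Area m) : ℝ) ^ 2 / 4 * t := by
    intro x y t
    simp only [S, ← Finset.sum_mul, ← Finset.mul_sum, sum_weight]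
    ring
  have hle : ∀ x y (f g : Area m → Area m → ℝ),
      (∀ a b : Area m, a.bit = x → b.bit = y → f a b ≤ g a b) → S x y f ≤ S x y g := by
    intro x y f g h
    refine Finset.sum_le_sum fun a _ => Finset.sum_le_sum fun b _ => ?_
    unfold Area.weight
    split_ifs with h1 h2
    · simpa using h a b h1 h2
    all_goals simp
  have h1 := hle true true (fun _ _ => 1 - ε) r fun a b ha hb => hout a b (ha.trans hb.symm)
  have h2 := hle true false r (fun _ _ => ε) fun a b ha hb => hin a b (by simp [ha, hb])
  have h3 := hle false true r (fun _ _ => ε) fun a b ha hb => hin a b (by simp [ha, hb])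
  rw [hconst] at h1 h2 h3
  have hK : (0 : ℝ) < (Fintype.card (Area m) : ℝ) ^ 2 := by
    have : Nonempty (Area m) := ⟨(fun _ => false, (⟨0, hm⟩, ⟨0, hm⟩))⟩
    have : 0 < Fintype.card (Area m) := Fintype.card_pos
    positivity
  -- Each pair of bits has a quarter of the total weight, so the estimates combine to `(1 - ε) / 4 ≤
  -- 2 * (ε / 4) + 1 / 10`, that is `ε ≥ 1 / 5`.
  nlinarith

/-- A deterministic algorithm is a randomized one over a one-point space, with error `0`. -/
theorem oneMarkedEdge_notMem_hybrid {𝒢 : GraphClass} {N : ℕ → ℕ} (hN : ∀ n, n ≤ N n)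
    (h𝒢 : ∀ (n : ℕ) (G : SimpleGraph (Fin n)), G.Connected → G ∈ 𝒢 n) (k : ℕ) :
    oneMarkedEdge ∉ Hybrid 𝒢 N (.bcc :: List.replicate k .loc) := by
  rintro ⟨A, c, hA, hdec⟩
  refine oneMarkedEdge_notMem_randHybrid hN h𝒢 (show (0 : ℝ) < 1 / 5 by norm_num) k
    ⟨Unit, ⊤, Measure.dirac (), inferInstance, fun _ => A, c, fun _ => hA, fun X I hX => ?_⟩
  refine ⟨trivial, fun h => ?_, fun h => ?_⟩
  · simp [(hdec X I hX).1 h]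
  · have h' := mt (hdec X I hX).2 h
    simp [h']

/-! ### The algorithm with a CONGEST and a BCC round -/

/-- The states of `countingAlgorithm`. -/
inductive CountingState
  | start (id : ℕ) (label : List Bool)
  | middle (id : ℕ) (label : List Bool) (marked : Set ℕ)
  | done (verdict : Prop)

open Classical in
/-- In the CONGEST round the nodes send whether they are marked, and in the BCC round whether they
are an endpoint of a marked edge. An endpoint of a marked edge accepts if its only marked neighbor
is the only other endpoint; any other node accepts if there is an endpoint. -/
noncomputable def countingAlgorithm : Algorithm where
  State := CountingState
  init x := .start x.id x.label
  send
    | .start _ l, _ => [decide (l = [true])]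
    | _, _ => []
  bcast
    | .middle _ l M => [decide (l = [true] ∧ M.Nonempty)]
    | _ => []
  step
    | .start i l, M => .middle i l {j | (j, [true]) ∈ M}
    | .middle _ l M, E => .done ((l = [false] ∨ l = [true]) ∧
        if l = [true] ∧ M.Nonempty then ∃ j, M = {j} ∧ {i | (i, [true]) ∈ E} = {j}
        else ∃ i, (i, [true]) ∈ E)
    | .done p, _ => .done p
  accept
    | .done p => p
    | _ => False

/-- If all nodes accept, some endpoint `x` exists, and its test leaves a single other endpoint `y`,
adjacent to `x`. Every marked edge has both ends among the endpoints, so it is `xy`. One-bit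
messages suffice. -/
theorem oneMarkedEdge_mem_hybrid (𝒢 : GraphClass) (N : ℕ → ℕ) :
    oneMarkedEdge ∈ Hybrid 𝒢 N [.congest, .bcc] := by
  classical
  refine ⟨countingAlgorithm, 1, ?_, ?_⟩
  · intro X I _
    refine ⟨fun v u _ => ?_, fun v => ?_, trivial⟩
    · simp [Algorithm.initStates, countingAlgorithm]
    · simp [Algorithm.round, Algorithm.initStates, countingAlgorithm]
  intro X I _
  let mk : Fin X.n → Prop := fun v => X.label v = [true]
  let nb : Fin X.n → Set (Fin X.n) := fun v => {u | X.graph.Adj v u ∧ mk u}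
  let ep : Fin X.n → Prop := fun v => mk v ∧ (nb v).Nonempty
  have hmid : ∀ v, countingAlgorithm.round X I .congest (countingAlgorithm.initStates X I) v =
      .middle (I.id v) (X.label v) (I.id '' nb v) := by
    intro v
    simp only [Algorithm.round, Algorithm.initStates, countingAlgorithm, Algorithm.inbox]
    congr 1
    ext i
    constructor
    · rintro ⟨u, hu, h⟩
      simp at h
      exact ⟨u, ⟨hu, h.2⟩, h.1.symm⟩
    · rintro ⟨u, ⟨hu, h⟩, rfl⟩
      exact ⟨u, hu, by simpa using h⟩
  have hacc : countingAlgorithm.AllAccept X I [.congest, .bcc] ↔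
      ∀ v, (X.label v = [false] ∨ X.label v = [true]) ∧
        if ep v then ∃ w, nb v = {w} ∧ {u | u ≠ v ∧ ep u} = {w} else ∃ u, u ≠ v ∧ ep u := by
    refine forall_congr' fun v => ?_
    have hE : ∀ i, (i, [true]) ∈ countingAlgorithm.inbox X I (countingAlgorithm.round X I .congest
        (countingAlgorithm.initStates X I)) v .bcc ↔ i ∈ I.id '' {u | u ≠ v ∧ ep u} := by
      intro i
      constructor
      · rintro ⟨u, hu, h⟩
        rw [hmid] at h
        simp [countingAlgorithm] at h
        exact ⟨u, ⟨hu, h.2⟩, h.1.symm⟩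
      · rintro ⟨u, ⟨hu, h⟩, rfl⟩
        refine ⟨u, hu, ?_⟩
        rw [hmid]
        simpa [countingAlgorithm] using h
    -- Identifiers are distinct, so a test on sets of identifiers is a test on sets of nodes.
    have himg : ∀ s t : Set (Fin X.n), (∃ j, I.id '' s = {j} ∧ I.id '' t = {j}) ↔
        ∃ w, s = {w} ∧ t = {w} := by
      intro s t
      constructor
      · rintro ⟨j, hs, ht⟩
        obtain ⟨w, hw, rfl⟩ : j ∈ I.id '' s := hs ▸ rfl
        rw [← Set.image_singleton] at hs ht
        exact ⟨w, I.injective.image_injective hs, I.injective.image_injective ht⟩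
      · rintro ⟨w, rfl, rfl⟩
        exact ⟨I.id w, by simp⟩
    change countingAlgorithm.accept (countingAlgorithm.step (countingAlgorithm.round X I .congest
      (countingAlgorithm.initStates X I) v) (countingAlgorithm.inbox X I (countingAlgorithm.round
        X I .congest (countingAlgorithm.initStates X I)) v .bcc)) ↔ _
    generalize countingAlgorithm.inbox X I (countingAlgorithm.round
        X I .congest (countingAlgorithm.initStates X I)) v .bcc = E at hE
    rw [hmid]
    simp only [countingAlgorithm, hE, Set.image_nonempty]
    rw [Set.ofPred_mem_eq, himg]
    refine and_congr_right fun _ => ?_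
    have h2 : (∃ i, i ∈ I.id '' {u | u ≠ v ∧ ep u}) ↔ ∃ u, u ≠ v ∧ ep u := by
      constructor
      · rintro ⟨_, u, hu, -⟩; exact ⟨u, hu⟩
      · rintro ⟨u, hu⟩; exact ⟨_, u, hu, rfl⟩
    rw [h2]
  rw [hacc, forall_and]
  refine and_congr_right fun _ => ?_
  rw [Set.ncard_eq_one]
  have hmem : ∀ u v, s(u, v) ∈ {e ∈ X.graph.edgeSet | ∀ v ∈ e, X.label v = [true]} ↔
      X.graph.Adj u v ∧ mk u ∧ mk v := by
    intro u v
    simp [mk]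
  constructor
  · rintro ⟨e, he⟩
    induction e with | _ x y
    have hxy := (hmem x y).1 (he ▸ rfl)
    have huniq : ∀ u v, X.graph.Adj u v → mk u → mk v → u = x ∧ v = y ∨ u = y ∧ v = x := by
      intro u v h1 h2 h3
      have h4 := (hmem u v).2 ⟨h1, h2, h3⟩
      rw [he] at h4
      exact Sym2.eq_iff.1 h4
    have hne := hxy.1.ne
    have hx : ep x := ⟨hxy.2.1, y, hxy.1, hxy.2.2⟩
    have hy : ep y := ⟨hxy.2.2, x, hxy.1.symm, hxy.2.1⟩
    have hep : ∀ v, ep v → v = x ∨ v = y := by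
      rintro v ⟨h, w, h1, h2⟩
      exact (huniq v w h1 h h2).imp And.left And.left
    intro v
    split_ifs with hv
    · rcases hep v hv with rfl | rfl
      · refine ⟨y, ?_, ?_⟩
        · ext w
          constructor
          · rintro ⟨h1, h2⟩
            rcases huniq _ w h1 hxy.2.1 h2 with h | h
            · exact h.2
            · exact absurd h.1 hne
          · rintro rfl; exact ⟨hxy.1, hxy.2.2⟩
        · ext w
          constructor
          · rintro ⟨h1, h2⟩
            exact (hep w h2).resolve_left h1
          · rintro rfl; exact ⟨hne.symm, hy⟩
      · refine ⟨x, ?_, ?_⟩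
        · ext w
          constructor
          · rintro ⟨h1, h2⟩
            rcases huniq _ w h1 hxy.2.2 h2 with h | h
            · exact absurd h.1 hne.symm
            · exact h.2
          · rintro rfl; exact ⟨hxy.1.symm, hxy.2.1⟩
        · ext w
          constructor
          · rintro ⟨h1, h2⟩
            exact (hep w h2).resolve_right h1
          · rintro rfl; exact ⟨hne, hx⟩
    · exact ⟨x, by rintro rfl; exact hv hx, hx⟩
  · intro h
    -- The network is nonempty, and any accepting node is an endpoint or has heard from one. Without
    -- this requirement on other nodes, networks with no marked edge would be accepted.
    obtain ⟨x, hx⟩ : ∃ x, ep x := by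
      by_cases h0 : ep ⟨0, X.pos⟩
      · exact ⟨_, h0⟩
      · have := h ⟨0, X.pos⟩
        rw [if_neg h0] at this
        obtain ⟨u, -, hu⟩ := this
        exact ⟨u, hu⟩
    have h1 := h x
    rw [if_pos hx] at h1
    obtain ⟨y, hnb, hother⟩ := h1
    have hy : y ∈ nb x := hnb ▸ rfl
    refine ⟨s(x, y), Set.Subset.antisymm ?_ ?_⟩
    · intro e
      induction e with | _ u v
      intro he
      obtain ⟨h1, h2, h3⟩ := (hmem u v).1 he
      have hu : ep u := ⟨h2, v, h1, h3⟩
      have hv : ep v := ⟨h3, u, h1.symm, h2⟩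
      have hxy : ∀ w, ep w → w = x ∨ w = y := by
        intro w hw
        by_cases hwx : w = x
        · exact .inl hwx
        · have : w ∈ {u | u ≠ x ∧ ep u} := ⟨hwx, hw⟩
          rw [hother] at this
          exact .inr this
      have := h1.ne
      rw [Set.mem_singleton_iff, Sym2.eq_iff]
      rcases hxy u hu with rfl | rfl <;> rcases hxy v hv with rfl | rfl <;> simp_all
    · rintro _ rfl
      exact (hmem x y).2 ⟨hy.1, hx.1, hy.2⟩

end HybridModel

open HybridModel in
theorem mainTheorem3
    (N : ℕ → ℕ) (hN : ∀ n, n ≤ N n) (hpoly : ∃ p : Polynomial ℕ, ∀ n, N n ≤ p.eval n)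
    (𝒢 : GraphClass) (h𝒢 : ∀ (n : ℕ) (G : SimpleGraph (Fin n)), G.Connected → G ∈ 𝒢 n) :
    oneMarkedEdge ∈ (Hybrid 𝒢 N [.congest, .bcc]) \
        (⋃ k : ℕ, Hybrid 𝒢 N (.bcc :: List.replicate k .loc)) ∧
      ∀ ε : ℝ, ε < 1 / 5 →
        oneMarkedEdge ∉ ⋃ k : ℕ, RandHybrid 𝒢 N ε (.bcc :: List.replicate k .loc) := by
  refine ⟨⟨oneMarkedEdge_mem_hybrid 𝒢 N, fun h => ?_⟩, fun ε hε h => ?_⟩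
  · obtain ⟨k, hk⟩ := Set.mem_iUnion.1 h
    exact oneMarkedEdge_notMem_hybrid hN h𝒢 k hk
  · obtain ⟨k, hk⟩ := Set.mem_iUnion.1 h
    exact oneMarkedEdge_notMem_randHybrid hN h𝒢 hε k hk
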